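/- Let $\mathcal{Y}$ be a measurable space (for instance $\mathbb{R}^d$ or a subset of it, with its Borel $\sigma$-algebra) and let $k:\mathcal{Y}\times\mathcal{Y}\to\mathbb{R}$ be a measurable, symmetric, positive-definite kernel (i.e. $\sum_{i,j}c_ic_jk(x_i,x_j)\ge 0$ for all finite families $x_i\in\mathcal{Y}$, $c_i\in\mathbb{R}$) with $|k(x,x)|\le 1$ for all $x$. Let $\mathcal{H}$ be its reproducing kernel Hilbert space, and for probability measures $\mu_1,\mu_2$ on $\mathcal{Y}$ put $$\mathcal{D}_{\mathrm{MMD}}(\mu_1,\mu_2)=\sup_{\|f\|_{\mathcal{H}}\le 1}\Bigl|\int f\,d\mu_1-\int f\,d\mu_2\Bigr| .$$ Let $\Theta$ be a measurable space (for instance a subset of $\mathbb{R}^p$) carrying a prior probability measure $\pi$, let $\{\mu_\theta:\theta\in\Theta\}$ be a family of probability measures on $\mathcal{Y}$ depending measurably on $\theta$ (a Markov kernel), let $\mu^*$ be any probability measure on $\mathcal{Y}$, and let $y_1,y_2,\dots$ be i.i.d. from $\mu^*$. Write $\hat\mu_{x_{1:n}}=n^{-1}\sum_{i=1}^n\delta_{x_i}$.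 For a fixed threshold $\varepsilon>0$ let $$p_n(\theta)=\int_{\mathcal{Y}^n}\mathbf{1}\{\mathcal{D}_{\mathrm{MMD}}(\hat\mu_{z_{1:n}},\hat\mu_{y_{1:n}})\le\varepsilon\}\,\mu_\theta^{n}(dz_{1:n}),\qquad p_n=\int_\Theta p_n(\theta)\,\pi(d\theta),$$ so that $p_n$ is the acceptance probability of rejection ABC; the ABC posterior is $\pi_n^{(\varepsilon)}(d\theta)=p_n^{-1}\,p_n(\theta)\,\pi(d\theta)$. Set $S_\varepsilon=\{\theta:\mathcal{D}_{\mathrm{MMD}}(\mu_\theta,\mu^*)\le\varepsilon\}$ and $\tilde\varepsilon=\inf\{\varepsilon'>0:\pi(S_{\varepsilon'})>0\}$. Assume $\pi\{\theta:\mathcal{D}_{\mathrm{MMD}}(\mu_\theta,\mu^*)=\varepsilon\}=0$ (i.e. $\varepsilon'\mapsto\pi(S_{\varepsilon'})$ is continuous at $\varepsilon$, which excludes at most countably many $\varepsilon$). Then: 1. Almost surely with respect to $(y_i)_{i\ge1}$, $p_n\to\pi(S_\varepsilon)$ as $n\to\infty$. 2. If $\varepsilon>\tilde\varepsilon$, then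 $\pi(S_\varepsilon)>0$ and, almost surely with respect to $(y_i)_{i\ge1}$: $\pi_n^{(\varepsilon)}$ is a well-defined probability measure for all large $n$, and it converges to the prior restricted to $S_\varepsilon$, $\pi(\cdot\mid S_\varepsilon)$, as $n\to\infty$, both in density, i.e. $$\frac{p_n(\theta)}{p_n}\to\frac{\mathbf{1}\{\theta\in S_\varepsilon\}}{\pi(S_\varepsilon)}\quad\text{for }\pi\text{-almost every }\theta,$$ and on events, i.e. $\pi_n^{(\varepsilon)}(A)\to\pi(A\mid S_\varepsilon)$ for every measurable $A\subseteq\Theta$. -/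

import Mathlib

open MeasureTheory ProbabilityTheory Filter Topology
open scoped ENNReal

noncomputable section

namespace ABC

variable {Y : Type*} {Θ : Type*}

/-- A real kernel `k`, written as the matrix of operators `t ↦ k x x' * t` on `ℝ`, which is the form
in which Mathlib takes the kernel of a reproducing kernel Hilbert space. -/
def kernelOp (k : Y → Y → ℝ) : Matrix Y Y (ℝ →L[ℝ] ℝ) :=
  Matrix.of fun x x' => k x x' • ContinuousLinearMap.id ℝ ℝ

theorem kernelOp_posSemidef {k : Y → Y → ℝ} (hk : (Matrix.of k).PosSemidef) :
    (kernelOp k).PosSemidef := by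
  have key := (RKHS.posSemidef_tfae (K := kernelOp k)).out 0 2
  refine key.mpr ⟨?_, fun v => ?_⟩
  · ext x x'
    have h := hk.isHermitian.apply x x'
    simp only [Matrix.of_apply, star_trivial] at h
    simp [kernelOp, h, ← ContinuousLinearMap.one_def]
  · have h := hk.2 v
    simp only [Matrix.of_apply, star_trivial] at h
    rw [Finsupp.sum_comm]
    convert! h using 1
    simp only [kernelOp, Matrix.of_apply, RCLike.re_to_real]
    refine Finsupp.sum_congr fun i _ => Finsupp.sum_congr fun j _ => ?_
    simp
    ring

/-- The unit ball `{f : ‖f‖_ℋ ≤ 1}`, as a set of functions on `Y`, of the reproducing kernel Hilbert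
space `ℋ` with (symmetric, positive definite) kernel `k`. -/
def rkhsUnitBall (k : Y → Y → ℝ) (hk : (Matrix.of k).PosSemidef) : Set (Y → ℝ) :=
  haveI : Fact (kernelOp k).PosSemidef := ⟨kernelOp_posSemidef hk⟩
  {f | ∃ h : RKHS.OfKernel (kernelOp k), ‖h‖ ≤ 1 ∧ ∀ x, f x = h x}

variable [MeasurableSpace Y] [MeasurableSpace Θ]

/-- The integral probability semimetric `sup_{f ∈ F} |∫ f dμ₁ - ∫ f dμ₂|` of a function class. -/
def ips (F : Set (Y → ℝ)) (μ₁ μ₂ : Measure Y) : ℝ≥0∞ :=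
  ⨆ f ∈ F, ENNReal.ofReal |∫ x, f x ∂μ₁ - ∫ x, f x ∂μ₂|

/-- The maximum mean discrepancy with kernel `k`. -/
def mmd (k : Y → Y → ℝ) (hk : (Matrix.of k).PosSemidef) (μ₁ μ₂ : Measure Y) : ℝ≥0∞ :=
  ips (rkhsUnitBall k hk) μ₁ μ₂

/-- The empirical distribution `n⁻¹ ∑ᵢ δ_{xᵢ}` of a sample of size `n`. -/
def empirical {n : ℕ} (x : Fin n → Y) : Measure Y :=
  (n : ℝ≥0∞)⁻¹ • ∑ i, Measure.dirac (x i)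

/-- The probability that an i.i.d. synthetic sample `z` of size `n` from the model at `θ` is within
discrepancy `ε` of the observed sample `y` of size `n`. -/
def acceptAt (D : Measure Y → Measure Y → ℝ≥0∞) (ε : ℝ) (μ : Kernel Θ Y) {n : ℕ} (y : Fin n → Y)
    (θ : Θ) : ℝ≥0∞ :=
  Measure.pi (fun _ : Fin n => μ θ) {z | D (empirical z) (empirical y) ≤ ENNReal.ofReal ε}

/-- The acceptance probability `p_n` of rejection ABC. -/
def acceptProb (D : Measure Y → Measure Y → ℝ≥0∞) (ε : ℝ) (μ : Kernel Θ Y) (prior : Measure Θ)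
    {n : ℕ} (y : Fin n → Y) : ℝ≥0∞ :=
  ∫⁻ θ, acceptAt D ε μ y θ ∂prior

/-- The density of the ABC posterior with respect to the prior. -/
def posteriorDensity (D : Measure Y → Measure Y → ℝ≥0∞) (ε : ℝ) (μ : Kernel Θ Y)
    (prior : Measure Θ) {n : ℕ} (y : Fin n → Y) (θ : Θ) : ℝ≥0∞ :=
  acceptAt D ε μ y θ / acceptProb D ε μ prior y

/-- The ABC posterior (a probability measure as soon as the acceptance probability is positive). -/
def posterior (D : Measure Y → Measure Y → ℝ≥0∞) (ε : ℝ) (μ : Kernel Θ Y)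
    (prior : Measure Θ) {n : ℕ} (y : Fin n → Y) : Measure Θ :=
  prior.withDensity (posteriorDensity D ε μ prior y)

/-- The set of parameters whose model is within discrepancy `ε` of `μstar`. -/
def withinSet (D : Measure Y → Measure Y → ℝ≥0∞) (ε : ℝ) (μ : Kernel Θ Y) (μstar : Measure Y) :
    Set Θ :=
  {θ | D (μ θ) μstar ≤ ENNReal.ofReal ε}

/-- The infimum of the `ε > 0` for which the parameters whose model is within discrepancy `ε` of
`μstar` have positive prior mass. -/
def criticalThreshold (D : Measure Y → Measure Y → ℝ≥0∞) (μ : Kernel Θ Y) (prior : Measure Θ)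
    (μstar : Measure Y) : ℝ :=
  sInf {ε : ℝ | 0 < ε ∧ 0 < prior (withinSet D ε μ μstar)}

end ABC

end

/-! Integration against `μ - ν` has a Riesz representer in the RKHS, so the MMD is its norm, the
square root of a double integral of `k` (`energyDist_nonneg_and_mmd_eq`). For an i.i.d. sample of
size `n` from `ν`, the off-diagonal terms of that double integral cancel in expectation, so the mean
squared MMD between the empirical measure and `ν` is at most `2 / n`
(`integral_energyDist_empirical_le`).

This bound is used twice. By Markov's inequality, synthetic samples concentrate around `μ θ`. Summed
along the squares, with the gaps filled deterministically, it gives almost sure convergence of the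
observed empirical measures to `μstar` (`ae_tendsto_mmd_empirical`).

Fix an observed sequence for which that convergence holds. By the triangle inequality the acceptance
probability at `θ` tends to 1 or 0 according to whether the discrepancy of `μ θ` from `μstar` is
below or above `ε` (`tendsto_acceptAt`); equality is null under the prior. Dominated convergence
(`tendsto_setLIntegral_acceptAt`) and division by the positive limit give the rest. -/

namespace RKHS

/-! ### Functions in an RKHS with bounded measurable kernel. -/

variable {Y H : Type*} [NormedAddCommGroup H] [InnerProductSpace ℝ H]
  [CompleteSpace H] [RKHS ℝ H Y ℝ]

theorem abs_apply_le_norm (hb : ∀ x, |kernel (𝕜 := ℝ) (V := ℝ) H x x 1| ≤ 1) (f : H) (x : Y) :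
    |f x| ≤ ‖f‖ := by
  have h : ‖kernel (𝕜 := ℝ) (V := ℝ) H x x‖ ≤ 1 := by
    refine ContinuousLinearMap.opNorm_le_of_unit_norm zero_le_one fun v hv => ?_
    rw [← mul_one v, ← smul_eq_mul, map_smul, norm_smul, hv, one_mul]
    exact hb x
  calc |f x| ≤ ‖f‖ * √‖kernel (𝕜 := ℝ) (V := ℝ) H x x‖ := norm_apply_le (𝕜 := ℝ) f x
    _ ≤ ‖f‖ * 1 := by gcongr; exact Real.sqrt_le_one.mpr h
    _ = ‖f‖ := mul_one _

variable [MeasurableSpace Y]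

/-- Norm convergence implies pointwise convergence, so the measurable elements form a closed
subspace. It contains the kernel sections, whose span is dense. -/
theorem measurable_coe_of_measurable_kernel
    (hm : ∀ y, Measurable fun x => kernel (𝕜 := ℝ) (V := ℝ) H x y 1) (f : H) :
    Measurable (f : Y → ℝ) := by
  let S : Submodule ℝ H :=
    { carrier := {f | Measurable (f : Y → ℝ)}
      add_mem' := fun {a b} ha hb => by
        simp only [Set.mem_ofPred_eq, coe_add (𝕜 := ℝ)] at *
        exact ha.add hb
      zero_mem' := by
        simp only [Set.mem_ofPred_eq, coe_zero (𝕜 := ℝ)]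
        exact measurable_const
      smul_mem' := fun c a ha => by
        simp only [Set.mem_ofPred_eq, coe_smul (𝕜 := ℝ)] at *
        exact ha.const_smul c }
  have hS : IsClosed (S : Set H) := by
    refine IsSeqClosed.isClosed fun u a hu ha => ?_
    refine measurable_of_tendsto_metrizable (f := fun n => (u n : Y → ℝ)) hu ?_
    rw [tendsto_pi_nhds]
    exact fun x => ((continuous_eval (𝕜 := ℝ) x).tendsto a).comp ha
  have hle : Submodule.topologicalClosure
      (Submodule.span ℝ {kerFun (𝕜 := ℝ) H x v | (x : Y) (v : ℝ)}) ≤ S := by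
    refine Submodule.topologicalClosure_minimal _ (Submodule.span_le.mpr ?_) hS
    rintro _ ⟨y, v, rfl⟩
    have : (kerFun (𝕜 := ℝ) H y v : Y → ℝ) = fun x => v * kernel (𝕜 := ℝ) (V := ℝ) H x y 1 := by
      funext x
      rw [kerFun_apply, ← smul_eq_mul, ← map_smul, smul_eq_mul, mul_one]
    change Measurable (kerFun (𝕜 := ℝ) H y v : Y → ℝ)
    rw [this]
    exact (hm y).const_mul v
  rw [kerFun_dense] at hle
  exact hle (Submodule.mem_top (x := f))

theorem integrable_coe (hm : ∀ y, Measurable fun x => kernel (𝕜 := ℝ) (V := ℝ) H x y 1)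
    (hb : ∀ x, |kernel (𝕜 := ℝ) (V := ℝ) H x x 1| ≤ 1) (f : H) (μ : Measure Y)
    [IsFiniteMeasure μ] : Integrable (f : Y → ℝ) μ :=
  .of_bound (measurable_coe_of_measurable_kernel hm f).aestronglyMeasurable ‖f‖
    (ae_of_all _ fun x => abs_apply_le_norm hb f x)

/-- The Riesz representer of `f ↦ ∫ f dμ - ∫ f dν` on a reproducing kernel Hilbert space. -/
theorem exists_representer (hm : ∀ y, Measurable fun x => kernel (𝕜 := ℝ) (V := ℝ) H x y 1)
    (hb : ∀ x, |kernel (𝕜 := ℝ) (V := ℝ) H x x 1| ≤ 1) (μ ν : Measure Y)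
    [IsFiniteMeasure μ] [IsFiniteMeasure ν] :
    ∃ g : H, ∀ f : H, inner ℝ g f = ∫ x, f x ∂μ - ∫ x, f x ∂ν := by
  let L : H →ₗ[ℝ] ℝ :=
    { toFun := fun f => ∫ x, f x ∂μ - ∫ x, f x ∂ν
      map_add' := fun f g => by
        simp only [coe_add (𝕜 := ℝ), Pi.add_apply]
        rw [integral_add (integrable_coe hm hb f μ) (integrable_coe hm hb g μ),
          integral_add (integrable_coe hm hb f ν) (integrable_coe hm hb g ν)]
        ring
      map_smul' := fun c f => by
        simp only [coe_smul (𝕜 := ℝ), Pi.smul_apply, integral_smul, RingHom.id_apply]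
        rw [smul_sub] }
  have hL : ∀ f, ‖L f‖ ≤ (μ.real Set.univ + ν.real Set.univ) * ‖f‖ := fun f => by
    have h (ρ : Measure Y) [IsFiniteMeasure ρ] : ‖∫ x, f x ∂ρ‖ ≤ ‖f‖ * ρ.real Set.univ :=
      norm_integral_le_of_norm_le_const (ae_of_all _ fun x => abs_apply_le_norm hb f x)
    calc ‖L f‖ ≤ ‖∫ x, f x ∂μ‖ + ‖∫ x, f x ∂ν‖ := norm_sub_le _ _
      _ ≤ ‖f‖ * μ.real Set.univ + ‖f‖ * ν.real Set.univ := add_le_add (h μ) (h ν)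
      _ = _ := by ring
  refine ⟨(InnerProductSpace.toDual ℝ H).symm (L.mkContinuous _ hL), fun f => ?_⟩
  rw [InnerProductSpace.toDual_symm_apply]
  rfl

end RKHS

/-! ### The MMD as an energy. -/

namespace ABC

noncomputable section

variable {Y : Type*}

theorem kernel_symm {k : Y → Y → ℝ} (hk : (Matrix.of k).PosSemidef) (x x' : Y) :
    k x x' = k x' x := by
  simpa using hk.isHermitian.apply x' x

/-- Cauchy–Schwarz for the kernel: the diagonal controls all values. -/
theorem kernel_abs_le_one {k : Y → Y → ℝ} (hk : (Matrix.of k).PosSemidef)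
    (hb : ∀ x, |k x x| ≤ 1) (x x' : Y) : |k x x'| ≤ 1 := by
  have : Fact (kernelOp k).PosSemidef := ⟨kernelOp_posSemidef hk⟩
  have h := RKHS.norm_kernel_le (𝕜 := ℝ) (V := ℝ) (RKHS.OfKernel (kernelOp k)) x x'
  have hn (a b : Y) : ‖kernelOp k a b‖ = |k a b| := by
    simp [kernelOp, norm_smul]
  rw [RKHS.OfKernel.kernel_ofKernel, hn, hn, hn] at h
  exact h.trans (mul_le_one₀ (Real.sqrt_le_one.mpr (hb x)) (Real.sqrt_nonneg _)
    (Real.sqrt_le_one.mpr (hb x')))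

theorem abs_le_one_of_mem_rkhsUnitBall {k : Y → Y → ℝ} {hk : (Matrix.of k).PosSemidef}
    (hb : ∀ x, |k x x| ≤ 1) {f : Y → ℝ} (hf : f ∈ rkhsUnitBall k hk) (x : Y) : |f x| ≤ 1 := by
  have : Fact (kernelOp k).PosSemidef := ⟨kernelOp_posSemidef hk⟩
  obtain ⟨h, hh, hf⟩ := hf
  rw [hf]
  refine (RKHS.abs_apply_le_norm (fun x => ?_) h x).trans hh
  rw [RKHS.OfKernel.kernel_ofKernel]
  simpa [kernelOp] using hb x

variable [MeasurableSpace Y]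

/-- The mutual energy `∬ k dμ dν`. -/
def energy (k : Y → Y → ℝ) (μ ν : Measure Y) : ℝ := ∫ x, ∫ x', k x x' ∂ν ∂μ

/-- The energy of the signed measure `μ - ν`. -/
def energyDist (k : Y → Y → ℝ) (μ ν : Measure Y) : ℝ :=
  energy k μ μ - 2 * energy k μ ν + energy k ν ν

theorem integrable_uncurry_kernel {k : Y → Y → ℝ} (hk : (Matrix.of k).PosSemidef)
    (hm : Measurable (Function.uncurry k)) (hb : ∀ x, |k x x| ≤ 1) (μ : Measure (Y × Y))
    [IsFiniteMeasure μ] : Integrable (Function.uncurry k) μ :=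
  .of_bound hm.aestronglyMeasurable 1 (ae_of_all _ fun p => kernel_abs_le_one hk hb p.1 p.2)

theorem energy_comm {k : Y → Y → ℝ} (hk : (Matrix.of k).PosSemidef)
    (hm : Measurable (Function.uncurry k)) (hb : ∀ x, |k x x| ≤ 1) (μ ν : Measure Y)
    [IsFiniteMeasure μ] [IsFiniteMeasure ν] : energy k μ ν = energy k ν μ := by
  unfold energy
  rw [integral_integral_swap (integrable_uncurry_kernel hk hm hb _)]
  simp_rw [kernel_symm hk]

theorem measurable_kernelMean {k : Y → Y → ℝ} (hm : Measurable (Function.uncurry k))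
    (ν : Measure Y) [IsFiniteMeasure ν] : Measurable fun x => ∫ x', k x x' ∂ν :=
  (hm.stronglyMeasurable.integral_prod_right (ν := ν)).measurable

theorem abs_kernelMean_le {k : Y → Y → ℝ} (hk : (Matrix.of k).PosSemidef)
    (hb : ∀ x, |k x x| ≤ 1) (ν : Measure Y) [IsProbabilityMeasure ν] (x : Y) :
    |∫ x', k x x' ∂ν| ≤ 1 := by
  simpa using norm_integral_le_of_norm_le_const (μ := ν) (f := k x) (C := 1)
    (ae_of_all _ fun x' => kernel_abs_le_one hk hb x x')

theorem integrable_kernelMean {k : Y → Y → ℝ} (hk : (Matrix.of k).PosSemidef)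
    (hm : Measurable (Function.uncurry k)) (hb : ∀ x, |k x x| ≤ 1) (μ ν : Measure Y)
    [IsFiniteMeasure μ] [IsFiniteMeasure ν] : Integrable (fun x => ∫ x', k x x' ∂ν) μ :=
  (integrable_uncurry_kernel hk hm hb (μ.prod ν)).integral_prod_left

theorem abs_energy_le {k : Y → Y → ℝ} (hk : (Matrix.of k).PosSemidef)
    (hb : ∀ x, |k x x| ≤ 1) (μ ν : Measure Y) [IsProbabilityMeasure μ] [IsProbabilityMeasure ν] :
    |energy k μ ν| ≤ 1 := by
  simpa [energy] using norm_integral_le_of_norm_le_const (μ := μ) (f := fun x => ∫ x', k x x' ∂ν) (C := 1)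
    (ae_of_all _ fun x => abs_kernelMean_le hk hb ν x)

/-- The maximum mean discrepancy is the square root of an energy. -/
theorem energyDist_nonneg_and_mmd_eq {k : Y → Y → ℝ} (hk : (Matrix.of k).PosSemidef)
    (hm : Measurable (Function.uncurry k)) (hb : ∀ x, |k x x| ≤ 1) (μ ν : Measure Y)
    [IsFiniteMeasure μ] [IsFiniteMeasure ν] :
    0 ≤ energyDist k μ ν ∧ mmd k hk μ ν = ENNReal.ofReal √(energyDist k μ ν) := by
  have : Fact (kernelOp k).PosSemidef := ⟨kernelOp_posSemidef hk⟩
  have hker (x x' : Y) :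
      RKHS.kernel (𝕜 := ℝ) (V := ℝ) (RKHS.OfKernel (kernelOp k)) x x' 1 = k x x' := by
    rw [RKHS.OfKernel.kernel_ofKernel]; simp [kernelOp]
  obtain ⟨g, hg⟩ := RKHS.exists_representer (H := RKHS.OfKernel (kernelOp k))
    (fun y => by simp only [hker]; exact hm.comp (measurable_id.prodMk measurable_const))
    (fun x => by rw [hker]; exact hb x) μ ν
  -- Testing the representer against the kernel section at `x` identifies it as the difference of
  -- the mean embeddings.
  have hgx (x : Y) : g x = ∫ x', k x x' ∂μ - ∫ x', k x x' ∂ν := by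
    have h := hg (RKHS.kerFun (𝕜 := ℝ) (RKHS.OfKernel (kernelOp k)) x (1 : ℝ))
    simp only [RKHS.inner_kerFun, RKHS.kerFun_apply, hker] at h
    simp_rw [kernel_symm hk x]
    simpa using h
  have hgg : ‖g‖ ^ 2 = energyDist k μ ν := by
    rw [← real_inner_self_eq_norm_sq, hg]
    simp_rw [hgx]
    rw [integral_sub (integrable_kernelMean hk hm hb _ _) (integrable_kernelMean hk hm hb _ _),
      integral_sub (integrable_kernelMean hk hm hb _ _) (integrable_kernelMean hk hm hb _ _)]
    change energy k μ μ - energy k μ ν - (energy k ν μ - energy k ν ν) = _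
    rw [energy_comm hk hm hb ν μ, energyDist]
    ring
  refine ⟨hgg ▸ sq_nonneg _, ?_⟩
  rw [← hgg, Real.sqrt_sq (norm_nonneg _)]
  have hint (f : Y → ℝ) (h : RKHS.OfKernel (kernelOp k)) (hf : ∀ x, f x = h x) :
      ∫ x, f x ∂μ - ∫ x, f x ∂ν = inner ℝ g h := by
    rw [hg]; simp_rw [hf]
  refine le_antisymm (iSup₂_le fun f hf => ?_) ?_
  · obtain ⟨h, hh, hf⟩ := hf
    rw [hint f h hf]
    refine ENNReal.ofReal_le_ofReal ((abs_real_inner_le_norm g h).trans ?_)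
    exact mul_le_of_le_one_right (norm_nonneg _) hh
  -- The supremum is attained at the normalised representer. If `g = 0`, the convention `0⁻¹ = 0`
  -- makes this the zero function, which still serves.
  · have hmem : (fun x => ((‖g‖⁻¹ • g : RKHS.OfKernel (kernelOp k)) : Y → ℝ) x) ∈
        rkhsUnitBall k hk := by
      refine ⟨‖g‖⁻¹ • g, ?_, fun x => rfl⟩
      rw [norm_smul, norm_inv, norm_norm]
      exact inv_mul_le_one
    refine le_trans ?_ (le_iSup₂ (f := fun f (_ : f ∈ rkhsUnitBall k hk) =>
      ENNReal.ofReal |∫ x, f x ∂μ - ∫ x, f x ∂ν|) _ hmem)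
    rw [hint _ (‖g‖⁻¹ • g) fun x => rfl, real_inner_smul_right, real_inner_self_eq_norm_sq]
    refine ENNReal.ofReal_le_ofReal (le_of_eq ?_)
    rw [abs_of_nonneg (by positivity)]
    by_cases h0 : ‖g‖ = 0
    · simp [h0]
    · field_simp

theorem measurable_of_mem_rkhsUnitBall {k : Y → Y → ℝ} {hk : (Matrix.of k).PosSemidef}
    (hm : Measurable (Function.uncurry k)) {f : Y → ℝ} (hf : f ∈ rkhsUnitBall k hk) :
    Measurable f := by
  have : Fact (kernelOp k).PosSemidef := ⟨kernelOp_posSemidef hk⟩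
  obtain ⟨h, -, hf⟩ := hf
  rw [funext hf]
  refine RKHS.measurable_coe_of_measurable_kernel (fun y => ?_) h
  rw [RKHS.OfKernel.kernel_ofKernel]
  simpa [kernelOp, Function.comp_def] using hm.comp (measurable_id.prodMk measurable_const)

end

end ABC

/-! ### Semimetric properties and empirical measures. -/

namespace ABC

variable {Y : Type*} [MeasurableSpace Y]

theorem ips_comm (F : Set (Y → ℝ)) (μ ν : Measure Y) : ips F μ ν = ips F ν μ := by
  simp only [ips, abs_sub_comm]

theorem ips_triangle (F : Set (Y → ℝ)) (μ ν ρ : Measure Y) :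
    ips F μ ρ ≤ ips F μ ν + ips F ν ρ := by
  refine iSup₂_le fun f hf => ?_
  calc ENNReal.ofReal |∫ x, f x ∂μ - ∫ x, f x ∂ρ|
      ≤ ENNReal.ofReal (|∫ x, f x ∂μ - ∫ x, f x ∂ν| + |∫ x, f x ∂ν - ∫ x, f x ∂ρ|) :=
        ENNReal.ofReal_le_ofReal (abs_sub_le _ _ _)
    _ = ENNReal.ofReal |∫ x, f x ∂μ - ∫ x, f x ∂ν| +
          ENNReal.ofReal |∫ x, f x ∂ν - ∫ x, f x ∂ρ| :=
        ENNReal.ofReal_add (abs_nonneg _) (abs_nonneg _)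
    _ ≤ _ := add_le_add
        (le_iSup₂ (f := fun f (_ : f ∈ F) => ENNReal.ofReal |∫ x, f x ∂μ - ∫ x, f x ∂ν|) f hf)
        (le_iSup₂ (f := fun f (_ : f ∈ F) => ENNReal.ofReal |∫ x, f x ∂ν - ∫ x, f x ∂ρ|) f hf)

/-- The empty sample has to be excluded: its empirical measure is zero. -/
instance isProbabilityMeasure_empirical {n : ℕ} [NeZero n] (x : Fin n → Y) :
    IsProbabilityMeasure (empirical x) := by
  constructor
  simp [empirical, ENNReal.inv_mul_cancel, NeZero.ne n]

theorem integral_empirical {n : ℕ} (x : Fin n → Y) {f : Y → ℝ} (hf : Measurable f) :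
    ∫ y, f y ∂(empirical x) = (n : ℝ)⁻¹ * ∑ i, f (x i) := by
  rw [empirical, integral_smul_measure, integral_finsetSum_measure]
  · simp [integral_dirac' _ _ hf.stronglyMeasurable]
  · exact fun i _ => integrable_dirac' hf.stronglyMeasurable (by simp)

variable {k : Y → Y → ℝ}

theorem energy_empirical_left (hm : Measurable (Function.uncurry k)) {n : ℕ} (x : Fin n → Y)
    (ν : Measure Y) [IsFiniteMeasure ν] :
    energy k (empirical x) ν = (n : ℝ)⁻¹ * ∑ i, ∫ x', k (x i) x' ∂ν :=
  integral_empirical x (measurable_kernelMean hm ν)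

theorem energy_empirical_self (hm : Measurable (Function.uncurry k)) {n : ℕ} [NeZero n]
    (x : Fin n → Y) :
    energy k (empirical x) (empirical x) =
      (n : ℝ)⁻¹ * ∑ i, (n : ℝ)⁻¹ * ∑ j, k (x i) (x j) := by
  rw [energy_empirical_left hm]
  congr! 2 with i
  exact integral_empirical x (hm.comp (measurable_const.prodMk measurable_id))

theorem energyDist_empirical (hm : Measurable (Function.uncurry k)) {n : ℕ} [NeZero n]
    (x : Fin n → Y) (ν : Measure Y) [IsFiniteMeasure ν] :
    energyDist k (empirical x) ν = (n : ℝ)⁻¹ * ∑ i, (n : ℝ)⁻¹ * ∑ j, k (x i) (x j)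
      - 2 * ((n : ℝ)⁻¹ * ∑ i, ∫ x', k (x i) x' ∂ν) + energy k ν ν := by
  rw [energyDist, energy_empirical_self hm, energy_empirical_left hm]

theorem measurable_kernel_eval (hm : Measurable (Function.uncurry k)) {n : ℕ} (i j : Fin n) :
    Measurable fun x : Fin n → Y => k (x i) (x j) := by
  have h : Measurable fun x : Fin n → Y => (x i, x j) := by fun_prop
  exact hm.comp h

theorem measurable_energyDist_empirical (hm : Measurable (Function.uncurry k)) {n : ℕ} [NeZero n]
    (ν : Measure Y) [IsFiniteMeasure ν] :
    Measurable fun x : Fin n → Y => energyDist k (empirical x) ν := by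
  simp_rw [energyDist_empirical hm]
  have h1 (i j : Fin n) : Measurable fun x : Fin n → Y => k (x i) (x j) :=
    measurable_kernel_eval hm i j
  have h2 (i : Fin n) : Measurable fun x : Fin n → Y => ∫ x', k (x i) x' ∂ν :=
    (measurable_kernelMean hm ν).comp (measurable_pi_apply i)
  fun_prop

/-- A supremum over a possibly uncountable class need not be measurable; the energy formula reduces
it to finite sums of measurable functions. -/
theorem measurable_mmd_empirical (hk : (Matrix.of k).PosSemidef)
    (hm : Measurable (Function.uncurry k)) (hb : ∀ x, |k x x| ≤ 1) {n : ℕ} [NeZero n]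
    (ν : Measure Y) [IsFiniteMeasure ν] :
    Measurable fun x : Fin n → Y => mmd k hk (empirical x) ν := by
  simp_rw [fun x : Fin n → Y => (energyDist_nonneg_and_mmd_eq hk hm hb (empirical x) ν).2]
  exact (measurable_energyDist_empirical hm ν).sqrt.ennreal_ofReal

theorem mmd_sq (hk : (Matrix.of k).PosSemidef) (hm : Measurable (Function.uncurry k))
    (hb : ∀ x, |k x x| ≤ 1) (μ ν : Measure Y) [IsFiniteMeasure μ] [IsFiniteMeasure ν] :
    mmd k hk μ ν ^ 2 = ENNReal.ofReal (energyDist k μ ν) := by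
  obtain ⟨h0, h⟩ := energyDist_nonneg_and_mmd_eq hk hm hb μ ν
  rw [h, ← ENNReal.ofReal_pow (Real.sqrt_nonneg _), Real.sq_sqrt h0]

theorem mmd_le_two (hk : (Matrix.of k).PosSemidef) (hb : ∀ x, |k x x| ≤ 1) (μ ν : Measure Y)
    [IsProbabilityMeasure μ] [IsProbabilityMeasure ν] : mmd k hk μ ν ≤ ENNReal.ofReal 2 := by
  refine iSup₂_le fun f hf => ENNReal.ofReal_le_ofReal ?_
  have h (ρ : Measure Y) [IsProbabilityMeasure ρ] : |∫ x, f x ∂ρ| ≤ 1 := by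
    simpa using norm_integral_le_of_norm_le_const (μ := ρ) (f := f) (C := 1)
      (ae_of_all _ fun x => abs_le_one_of_mem_rkhsUnitBall hb hf x)
  have h1 := abs_le.mp (h μ)
  have h2 := abs_le.mp (h ν)
  rw [abs_le]
  constructor <;> linarith

/-! ### Second moment of the MMD of an i.i.d. sample. -/

section iid

variable (ν : Measure Y) [IsProbabilityMeasure ν] {n : ℕ}

theorem hasLaw_eval_pi (i : Fin n) : HasLaw (fun z : Fin n → Y => z i) ν (Measure.pi fun _ => ν) :=
  (measurePreserving_eval (fun _ => ν) i).hasLaw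

theorem integral_kernel_pi_of_ne (hk : (Matrix.of k).PosSemidef)
    (hm : Measurable (Function.uncurry k)) (hb : ∀ x, |k x x| ≤ 1) {i j : Fin n} (hij : i ≠ j) :
    ∫ z, k (z i) (z j) ∂(Measure.pi fun _ : Fin n => ν) = energy k ν ν := by
  have hind : iIndepFun (fun (i : Fin n) (z : Fin n → Y) => z i) (Measure.pi fun _ => ν) :=
    iIndepFun_pi (X := fun _ => id) fun _ => aemeasurable_id
  have hlaw := (hind.indepFun hij).hasLaw_prod (hasLaw_eval_pi ν i) (hasLaw_eval_pi ν j)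
  have h := hlaw.integral_comp (f := Function.uncurry k) hm.aestronglyMeasurable
  rw [integral_prod _ (integrable_uncurry_kernel hk hm hb _)] at h
  exact h

theorem integrable_kernel_pi (hk : (Matrix.of k).PosSemidef)
    (hm : Measurable (Function.uncurry k)) (hb : ∀ x, |k x x| ≤ 1) (i j : Fin n) :
    Integrable (fun z => k (z i) (z j)) (Measure.pi fun _ : Fin n => ν) :=
  .of_bound (measurable_kernel_eval hm i j).aestronglyMeasurable 1 (ae_of_all _ fun _ => kernel_abs_le_one hk hb _ _)

theorem integrable_kernelMean_pi (hk : (Matrix.of k).PosSemidef)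
    (hm : Measurable (Function.uncurry k)) (hb : ∀ x, |k x x| ≤ 1) (i : Fin n) :
    Integrable (fun z => ∫ x', k (z i) x' ∂ν) (Measure.pi fun _ : Fin n => ν) :=
  .of_bound ((measurable_kernelMean hm ν).comp (measurable_pi_apply i)).aestronglyMeasurable
    1 (ae_of_all _ fun _ => abs_kernelMean_le hk hb ν _)

theorem integral_kernelMean_pi (hm : Measurable (Function.uncurry k)) (i : Fin n) :
    ∫ z, ∫ x', k (z i) x' ∂ν ∂(Measure.pi fun _ : Fin n => ν) = energy k ν ν :=
  (hasLaw_eval_pi ν i).integral_comp (measurable_kernelMean hm ν).aestronglyMeasurable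

/-- Off the diagonal independence gives equality. On it, the integral is at most 1 and the energy at
least -1, whence the excess 2. -/
theorem integral_kernel_pi_le (hk : (Matrix.of k).PosSemidef)
    (hm : Measurable (Function.uncurry k)) (hb : ∀ x, |k x x| ≤ 1) (i j : Fin n) :
    ∫ z, k (z i) (z j) ∂(Measure.pi fun _ : Fin n => ν) ≤
      energy k ν ν + if i = j then 2 else 0 := by
  split_ifs with h
  · have h1 : ∫ z, k (z i) (z j) ∂(Measure.pi fun _ : Fin n => ν) ≤ 1 := by
      have := norm_integral_le_of_norm_le_const (μ := Measure.pi fun _ : Fin n => ν)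
        (f := fun z => k (z i) (z j)) (C := 1) (ae_of_all _ fun _ => kernel_abs_le_one hk hb _ _)
      rw [probReal_univ, mul_one] at this
      exact (le_abs_self _).trans this
    have h2 := (abs_le.mp (abs_energy_le hk hb ν ν)).1
    linarith
  · rw [integral_kernel_pi_of_ne ν hk hm hb h, add_zero]

theorem integrable_energyDist_empirical (hk : (Matrix.of k).PosSemidef)
    (hm : Measurable (Function.uncurry k)) (hb : ∀ x, |k x x| ≤ 1) [NeZero n] :
    Integrable (fun z : Fin n → Y => energyDist k (empirical z) ν) (Measure.pi fun _ => ν) := by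
  simp_rw [energyDist_empirical hm]
  refine .add (.sub ?_ ?_) (integrable_const _)
  · exact (integrable_finsetSum _ fun i _ =>
      (integrable_finsetSum _ fun j _ => integrable_kernel_pi ν hk hm hb i j).const_mul _).const_mul _
  · exact ((integrable_finsetSum _ fun i _ =>
      integrable_kernelMean_pi ν hk hm hb i).const_mul _).const_mul _

/-- The energies cancel, leaving only the excess of the `n` diagonal terms among `n ^ 2`, that is `n
* 2 / n ^ 2`. -/
theorem integral_energyDist_empirical_le (hk : (Matrix.of k).PosSemidef)
    (hm : Measurable (Function.uncurry k)) (hb : ∀ x, |k x x| ≤ 1) [NeZero n] :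
    ∫ z : Fin n → Y, energyDist k (empirical z) ν ∂(Measure.pi fun _ => ν) ≤ 2 / n := by
  have hn : (n : ℝ) ≠ 0 := Nat.cast_ne_zero.mpr (NeZero.ne n)
  simp_rw [energyDist_empirical hm]
  have i1 (i : Fin n) : Integrable (fun z => (n : ℝ)⁻¹ * ∑ j, k (z i) (z j))
      (Measure.pi fun _ : Fin n => ν) :=
    (integrable_finsetSum _ fun j _ => integrable_kernel_pi ν hk hm hb i j).const_mul _
  have i2 : Integrable (fun z => (n : ℝ)⁻¹ * ∑ i, (n : ℝ)⁻¹ * ∑ j, k (z i) (z j))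
      (Measure.pi fun _ : Fin n => ν) := (integrable_finsetSum _ fun i _ => i1 i).const_mul _
  have i3 : Integrable (fun z => 2 * ((n : ℝ)⁻¹ * ∑ i, ∫ x', k (z i) x' ∂ν))
      (Measure.pi fun _ : Fin n => ν) :=
    ((integrable_finsetSum _ fun i _ => integrable_kernelMean_pi ν hk hm hb i).const_mul _).const_mul _
  rw [integral_add (f := fun z : Fin n → Y => (n : ℝ)⁻¹ * ∑ i, (n : ℝ)⁻¹ * ∑ j, k (z i) (z j) -
      2 * ((n : ℝ)⁻¹ * ∑ i, ∫ x', k (z i) x' ∂ν)) (i2.sub i3) (integrable_const _), integral_sub i2 i3, integral_const_mul,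
    integral_finsetSum _ fun i _ => i1 i, integral_const_mul, integral_const_mul,
    integral_finsetSum _ fun i _ => integrable_kernelMean_pi ν hk hm hb i]
  simp_rw [integral_const_mul, integral_kernelMean_pi ν hm,
    fun i => integral_finsetSum (Finset.univ : Finset (Fin n))
      fun j _ => integrable_kernel_pi ν hk hm hb i j]
  have hle : (n : ℝ)⁻¹ * ∑ i : Fin n, (n : ℝ)⁻¹ *
      ∑ j : Fin n, ∫ z, k (z i) (z j) ∂(Measure.pi fun _ : Fin n => ν) ≤
      (n : ℝ)⁻¹ * ∑ i : Fin n, (n : ℝ)⁻¹ *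
        ∑ j : Fin n, (energy k ν ν + if i = j then 2 else 0) := by
    gcongr with i _ j _
    exact integral_kernel_pi_le ν hk hm hb i j
  have heq : (n : ℝ)⁻¹ * ∑ i : Fin n, (n : ℝ)⁻¹ *
        ∑ j : Fin n, (energy k ν ν + if i = j then 2 else 0) = energy k ν ν + 2 / n := by
    simp [Finset.sum_add_distrib]
    field_simp
  have heq' : (n : ℝ)⁻¹ * ∑ _i : Fin n, energy k ν ν = energy k ν ν := by
    simp [hn]
  rw [heq', integral_const, probReal_univ, one_smul]
  linarith

theorem lintegral_mmd_empirical_sq_le (hk : (Matrix.of k).PosSemidef)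
    (hm : Measurable (Function.uncurry k)) (hb : ∀ x, |k x x| ≤ 1) [NeZero n] :
    ∫⁻ z : Fin n → Y, mmd k hk (empirical z) ν ^ 2 ∂(Measure.pi fun _ => ν) ≤
      ENNReal.ofReal (2 / n) := by
  simp_rw [fun z : Fin n → Y => mmd_sq hk hm hb (empirical z) ν]
  rw [← ofReal_integral_eq_lintegral_ofReal (integrable_energyDist_empirical ν hk hm hb)
    (ae_of_all _ fun z => (energyDist_nonneg_and_mmd_eq hk hm hb _ _).1)]
  exact ENNReal.ofReal_le_ofReal (integral_energyDist_empirical_le ν hk hm hb)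

theorem pi_le_mmd_empirical_le (hk : (Matrix.of k).PosSemidef)
    (hm : Measurable (Function.uncurry k)) (hb : ∀ x, |k x x| ≤ 1) [NeZero n] {δ : ℝ≥0∞}
    (hδ : δ ≠ 0) (hδ' : δ ≠ ∞) :
    (Measure.pi fun _ : Fin n => ν) {z | δ ≤ mmd k hk (empirical z) ν} ≤
      ENNReal.ofReal (2 / n) / δ ^ 2 := by
  have hmeas := (measurable_mmd_empirical hk hm hb (n := n) ν).pow_const 2
  refine le_trans (measure_mono fun z hz => ?_) ((meas_ge_le_lintegral_div
    (μ := Measure.pi fun _ : Fin n => ν) hmeas.aemeasurable (pow_ne_zero 2 hδ)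
    (ENNReal.pow_ne_top hδ')).trans
      (ENNReal.div_le_div_right (lintegral_mmd_empirical_sq_le ν hk hm hb) _))
  exact pow_le_pow_left' (a := δ) hz 2

end iid

end ABC

/-! ### Almost sure convergence of empirical measures; measurability in the parameter. -/

namespace ABC

variable {Y Θ Ω : Type*} [MeasurableSpace Y] [MeasurableSpace Θ] [MeasurableSpace Ω]
  {k : Y → Y → ℝ}

/-- Enlarging a sample of size `m` to size `n` increases the discrepancy by at most `2 (n - m) / n`. -/
theorem mmd_empirical_le_add (hk : (Matrix.of k).PosSemidef)
    (hm : Measurable (Function.uncurry k)) (hb : ∀ x, |k x x| ≤ 1) (ν : Measure Y)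
    [IsProbabilityMeasure ν] (x : ℕ → Y) {m n : ℕ} (hm0 : m ≠ 0) (hmn : m ≤ n) :
    mmd k hk (empirical fun i : Fin n => x i) ν ≤
      mmd k hk (empirical fun i : Fin m => x i) ν + ENNReal.ofReal (2 * (n - m) / n) := by
  have hmpos : (0 : ℝ) < m := by positivity
  have hmn' : (m : ℝ) ≤ n := by exact_mod_cast hmn
  have hnpos : (0 : ℝ) < n := hmpos.trans_le hmn'
  refine iSup₂_le fun f hf => ?_
  have hfm := measurable_of_mem_rkhsUnitBall hm hf
  have hf1 := abs_le_one_of_mem_rkhsUnitBall hb hf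
  set c := ∫ y, f y ∂ν
  have hc : |c| ≤ 1 := by
    simpa using norm_integral_le_of_norm_le_const (μ := ν) (f := f) (C := 1)
      (ae_of_all _ fun y => hf1 y)
  -- Centring at `c` writes both errors as partial sums of one sequence. The first `m` terms then
  -- only lose weight, since `n⁻¹ ≤ m⁻¹`, and each later term is at most 2.
  have hemp {l : ℕ} (hl : (0 : ℝ) < l) : ∫ y, f y ∂(empirical fun i : Fin l => x i) - c =
      (l : ℝ)⁻¹ * ∑ i ∈ Finset.range l, (f (x i) - c) := by
    rw [integral_empirical _ hfm, Fin.sum_univ_eq_sum_range (fun i => f (x i)),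
      Finset.sum_sub_distrib]
    simp only [Finset.sum_const, Finset.card_range, nsmul_eq_mul]
    field_simp
  have htail : |∑ i ∈ Finset.Ico m n, (f (x i) - c)| ≤ 2 * (n - m) := by
    refine (Finset.abs_sum_le_sum_abs _ _).trans ?_
    refine (Finset.sum_le_card_nsmul _ _ 2 fun i _ => ?_).trans_eq ?_
    · exact (abs_sub _ _).trans (by linarith [hf1 (x i)])
    · rw [Nat.card_Ico, nsmul_eq_mul, Nat.cast_sub hmn, mul_comm]
  have hbound : |∫ y, f y ∂(empirical fun i : Fin n => x i) - c| ≤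
      |∫ y, f y ∂(empirical fun i : Fin m => x i) - c| + 2 * (n - m) / n := by
    rw [hemp hnpos, hemp hmpos, ← Finset.sum_range_add_sum_Ico _ hmn, mul_add]
    refine (abs_add_le _ _).trans (add_le_add ?_ ?_)
    · rw [abs_mul, abs_mul, abs_of_pos (inv_pos.mpr hnpos), abs_of_pos (inv_pos.mpr hmpos)]
      gcongr
    · rw [abs_mul, abs_of_pos (inv_pos.mpr hnpos), inv_mul_eq_div]
      gcongr
  refine (ENNReal.ofReal_le_ofReal hbound).trans (ENNReal.ofReal_add_le.trans ?_)
  gcongr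
  exact le_iSup₂ (f := fun f (_ : f ∈ rkhsUnitBall k hk) => ENNReal.ofReal
    |∫ y, f y ∂(empirical fun i : Fin m => x i) - ∫ y, f y ∂ν|) f hf

/-- Almost sure convergence of the empirical distribution in maximum mean discrepancy. -/
theorem ae_tendsto_mmd_empirical (hk : (Matrix.of k).PosSemidef)
    (hm : Measurable (Function.uncurry k)) (hb : ∀ x, |k x x| ≤ 1) {ν : Measure Y}
    [IsProbabilityMeasure ν] {P : Measure Ω} {y : ℕ → Ω → Y}
    (hlaw : ∀ i, HasLaw (y i) ν P) (hind : iIndepFun y P) :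
    ∀ᵐ ω ∂P, Tendsto (fun n : ℕ => mmd k hk (empirical fun i : Fin n => y i ω) ν) atTop (𝓝 0) := by
  let D (n : ℕ) (ω : Ω) : ℝ≥0∞ := mmd k hk (empirical fun i : Fin n => y i ω) ν
  have hpi (n : ℕ) : HasLaw (fun ω (i : Fin n) => y i ω) (Measure.pi fun _ => ν) P :=
    (hind.precomp Fin.val_injective).hasLaw_pi fun i : Fin n => hlaw i
  -- The moment bound `2 / n` is summable only along a subsequence such as the squares; the shift by
  -- one keeps the samples nonempty.
  have hmeas (j : ℕ) : AEMeasurable (fun ω => D ((j + 1) ^ 2) ω ^ 2) P :=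
    ((measurable_mmd_empirical hk hm hb (n := (j + 1) ^ 2) ν).pow_const 2).comp_aemeasurable
      (hpi _).aemeasurable
  have hint (j : ℕ) : ∫⁻ ω, D ((j + 1) ^ 2) ω ^ 2 ∂P ≤
      ENNReal.ofReal (2 * (1 / ((j : ℝ) + 1) ^ 2)) := by
    have h := (hpi ((j + 1) ^ 2)).lintegral_comp
      (f := fun z : Fin ((j + 1) ^ 2) → Y => mmd k hk (empirical z) ν ^ 2)
      ((measurable_mmd_empirical hk hm hb ν).pow_const 2).aemeasurable
    refine h.trans_le ((lintegral_mmd_empirical_sq_le ν hk hm hb).trans_eq ?_)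
    push_cast
    rw [mul_one_div]
  have hsummable : Summable fun j : ℕ => 2 * (1 / ((j : ℝ) + 1) ^ 2) := by
    have h := (summable_nat_add_iff 1).mpr (Real.summable_one_div_nat_pow (p := 2) |>.mpr one_lt_two)
    exact (by simpa using h : Summable fun j : ℕ => (1 / ((j : ℝ) + 1) ^ 2)).mul_left 2
  have hsum : ∫⁻ ω, ∑' j, D ((j + 1) ^ 2) ω ^ 2 ∂P ≠ ∞ := by
    rw [lintegral_tsum hmeas]
    exact ne_top_of_le_ne_top hsummable.tsum_ofReal_ne_top (ENNReal.tsum_le_tsum hint)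
  filter_upwards [ae_lt_top' (AEMeasurable.tsum hmeas) hsum] with ω hω
  have hsq : Tendsto (fun j : ℕ => D ((j + 1) ^ 2) ω) atTop (𝓝 0) := by
    have h := (ENNReal.tendsto_atTop_zero_of_tsum_ne_top hω.ne).ennrpow_const (1 / 2)
    have hroot (a : ℝ≥0∞) : (a ^ 2) ^ (1 / 2 : ℝ) = a := by
      rw [← ENNReal.rpow_natCast, ← ENNReal.rpow_mul]
      norm_num
    simpa only [hroot, ENNReal.zero_rpow_of_pos one_half_pos] using h
  have hsq' : Tendsto (fun s : ℕ => D (s ^ 2) ω) atTop (𝓝 0) :=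
    (tendsto_add_atTop_iff_nat (f := fun s : ℕ => D (s ^ 2) ω) 1).mp hsq
  have hsqrt : Tendsto Nat.sqrt atTop atTop :=
    tendsto_atTop_atTop.mpr fun b => ⟨b * b, fun n hn => Nat.le_sqrt.mpr hn⟩
  -- With `s = n.sqrt`, `n - s ^ 2 ≤ 2 * s` and `s ^ 2 ≤ n`, so passing from `s ^ 2` to `n` costs at
  -- most `2 * (n - s ^ 2) / n ≤ 4 / s`.
  have hrest : Tendsto (fun s : ℕ => ENNReal.ofReal (4 / s)) atTop (𝓝 0) := by
    simpa using ENNReal.tendsto_ofReal (tendsto_const_div_atTop_nhds_zero_nat (4 : ℝ))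
  have hlim := (hsq'.add hrest).comp hsqrt
  rw [add_zero] at hlim
  refine tendsto_of_tendsto_of_tendsto_of_le_of_le' tendsto_const_nhds hlim
    (Eventually.of_forall fun _ => zero_le) ?_
  filter_upwards [eventually_ge_atTop 1] with n hn
  have hs : 0 < n.sqrt := Nat.sqrt_pos.mpr hn
  have hle : n.sqrt ^ 2 ≤ n := Nat.sqrt_le' n
  refine (mmd_empirical_le_add hk hm hb ν (fun i => y i ω) (pow_pos hs 2).ne' hle).trans ?_
  refine add_le_add le_rfl (ENNReal.ofReal_le_ofReal ?_)
  have hsr : (0 : ℝ) < n.sqrt := by exact_mod_cast hs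
  have hler : (n.sqrt : ℝ) ^ 2 ≤ n := by exact_mod_cast hle
  have hge : (n : ℝ) ≤ n.sqrt * n.sqrt + n.sqrt + n.sqrt := by exact_mod_cast Nat.sqrt_le_add n
  have hnr : (0 : ℝ) < n := by exact_mod_cast hn
  rw [div_le_div_iff₀ hnr hsr]
  push_cast
  nlinarith

/-- Measurability need only be tested on boxes, where the product measure is a finite product of
measurable functions of `θ`. -/
theorem measurable_pi_kernel (μ : Kernel Θ Y) [IsMarkovKernel μ] (n : ℕ) :
    Measurable fun θ => Measure.pi fun _ : Fin n => μ θ := by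
  refine .measure_of_isPiSystem_of_isProbabilityMeasure generateFrom_pi.symm isPiSystem_pi ?_
  rintro _ ⟨s, hs, rfl⟩
  simp_rw [Measure.pi_pi]
  exact Finset.measurable_prod _ fun i _ => μ.measurable_coe (hs i (Set.mem_univ i))

theorem measurable_acceptAt (hk : (Matrix.of k).PosSemidef)
    (hm : Measurable (Function.uncurry k)) (hb : ∀ x, |k x x| ≤ 1) (ε : ℝ) (μ : Kernel Θ Y)
    [IsMarkovKernel μ] {n : ℕ} [NeZero n] (x : Fin n → Y) :
    Measurable (acceptAt (mmd k hk) ε μ x) :=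
  (Measure.measurable_coe (measurableSet_le (measurable_mmd_empirical hk hm hb (empirical x))
    measurable_const)).comp (measurable_pi_kernel μ n)

theorem measurable_energyDist_kernel (hm : Measurable (Function.uncurry k)) (μ : Kernel Θ Y)
    [IsMarkovKernel μ] (ν : Measure Y) [IsProbabilityMeasure ν] :
    Measurable fun θ => energyDist k (μ θ) ν := by
  have h1 : StronglyMeasurable fun θ => energy k (μ θ) (μ θ) := by
    refine StronglyMeasurable.integral_kernel_prod_right (κ := μ)
      (f := fun θ x => ∫ x', k x x' ∂(μ θ)) ?_
    -- Since `θ` enters both integrals, the inner one is taken jointly in `(θ, x)`, against a kernel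
    -- that ignores `x`.
    exact StronglyMeasurable.integral_kernel_prod_right (κ := μ.comap Prod.fst measurable_fst)
      (f := fun (p : Θ × Y) x' => k p.2 x')
      (hm.comp ((measurable_snd.comp measurable_fst).prodMk measurable_snd)).stronglyMeasurable
  have h2 : StronglyMeasurable fun θ => energy k (μ θ) ν :=
    (measurable_kernelMean hm ν).stronglyMeasurable.integral_kernel
  exact ((h1.measurable.sub (h2.measurable.const_mul 2)).add_const _)

theorem measurableSet_withinSet (hk : (Matrix.of k).PosSemidef)
    (hm : Measurable (Function.uncurry k)) (hb : ∀ x, |k x x| ≤ 1) (ε : ℝ) (μ : Kernel Θ Y)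
    [IsMarkovKernel μ] (ν : Measure Y) [IsProbabilityMeasure ν] :
    MeasurableSet (withinSet (mmd k hk) ε μ ν) := by
  refine measurableSet_le ?_ measurable_const
  simp_rw [fun θ => (energyDist_nonneg_and_mmd_eq hk hm hb (μ θ) ν).2]
  exact (measurable_energyDist_kernel hm μ ν).sqrt.ennreal_ofReal

theorem acceptAt_le_one (D : Measure Y → Measure Y → ℝ≥0∞) (ε : ℝ) (μ : Kernel Θ Y)
    [IsMarkovKernel μ] {n : ℕ} (x : Fin n → Y) (θ : Θ) : acceptAt D ε μ x θ ≤ 1 :=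
  prob_le_one

end ABC

/-! ### Limits of acceptance probabilities and of the posterior. -/

namespace ABC

variable {Y Θ : Type*} [MeasurableSpace Y] [MeasurableSpace Θ] {k : Y → Y → ℝ}

theorem tendsto_pi_le_mmd_empirical (hk : (Matrix.of k).PosSemidef)
    (hm : Measurable (Function.uncurry k)) (hb : ∀ x, |k x x| ≤ 1) (ν : Measure Y)
    [IsProbabilityMeasure ν] {δ : ℝ≥0∞} (hδ : δ ≠ 0) (hδ' : δ ≠ ∞) :
    Tendsto (fun n : ℕ => (Measure.pi fun _ : Fin n => ν) {z | δ ≤ mmd k hk (empirical z) ν})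
      atTop (𝓝 0) := by
  have hlim : Tendsto (fun n : ℕ => ENNReal.ofReal (2 / n) / δ ^ 2) atTop (𝓝 0) := by
    simpa using ENNReal.Tendsto.div_const
      (ENNReal.tendsto_ofReal (tendsto_const_div_atTop_nhds_zero_nat (2 : ℝ)))
      (Or.inr (pow_ne_zero 2 hδ))
  refine tendsto_of_tendsto_of_tendsto_of_le_of_le' tendsto_const_nhds hlim
    (Eventually.of_forall fun _ => zero_le) ?_
  filter_upwards [eventually_ge_atTop 1] with n hn
  have : NeZero n := ⟨by omega⟩
  exact pi_le_mmd_empirical_le ν hk hm hb hδ hδ'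

theorem tendsto_acceptAt_one (hk : (Matrix.of k).PosSemidef)
    (hm : Measurable (Function.uncurry k)) (hb : ∀ x, |k x x| ≤ 1) {ε : ℝ} {μ : Kernel Θ Y}
    [IsMarkovKernel μ] {ν : Measure Y} {x : ℕ → Y}
    (hx : Tendsto (fun n : ℕ => mmd k hk (empirical fun i : Fin n => x i) ν) atTop (𝓝 0))
    {θ : Θ} (hθ : mmd k hk (μ θ) ν < ENNReal.ofReal ε) :
    Tendsto (fun n : ℕ => acceptAt (mmd k hk) ε μ (fun i : Fin n => x i) θ) atTop (𝓝 1) := by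
  have hd := ENNReal.ofReal_toReal hθ.ne_top
  have hlt : (mmd k hk (μ θ) ν).toReal < ε := (ENNReal.lt_ofReal_iff_toReal_lt hθ.ne_top).mp hθ
  set r := (mmd k hk (μ θ) ν).toReal
  -- Half the gap for the synthetic sample's error and half for the observed sample's, so that the
  -- triangle inequality gives exactly `ε`.
  set δ := ENNReal.ofReal ((ε - r) / 2) with hδ
  have hδ0 : 0 < δ := ENNReal.ofReal_pos.mpr (by linarith)
  have hlim := tendsto_pi_le_mmd_empirical hk hm hb (μ θ) hδ0.ne' ENNReal.ofReal_ne_top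
  have hlim' := ENNReal.Tendsto.sub (tendsto_const_nhds (x := (1 : ℝ≥0∞))) hlim
    (Or.inl ENNReal.one_ne_top)
  rw [tsub_zero] at hlim'
  refine tendsto_of_tendsto_of_tendsto_of_le_of_le' hlim' tendsto_const_nhds ?_
    (Eventually.of_forall fun n => acceptAt_le_one _ _ _ _ _)
  filter_upwards [hx.eventually_le_const hδ0] with n hn
  rw [tsub_le_iff_right, ← measure_univ (μ := Measure.pi fun _ : Fin n => μ θ)]
  refine (measure_mono fun z _ => ?_).trans (measure_union_le _ _)
  by_cases hz : δ ≤ mmd k hk (empirical z) (μ θ)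
  · exact Or.inr hz
  · refine Or.inl ?_
    calc mmd k hk (empirical z) (empirical fun i : Fin n => x i)
        ≤ mmd k hk (empirical z) (μ θ) +
            (mmd k hk (μ θ) ν + mmd k hk ν (empirical fun i : Fin n => x i)) :=
          (ips_triangle _ _ (μ θ) _).trans (add_le_add le_rfl (ips_triangle _ _ ν _))
      _ ≤ δ + (ENNReal.ofReal r + δ) :=
          add_le_add (not_le.mp hz).le (add_le_add hd.ge ((ips_comm _ _ _).trans_le hn))
      _ = ENNReal.ofReal ε := by
          have hr : 0 ≤ r := ENNReal.toReal_nonneg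
          rw [hδ, ← ENNReal.ofReal_add hr (by linarith),
            ← ENNReal.ofReal_add (by linarith) (by linarith)]
          congr 1
          ring

theorem tendsto_acceptAt_zero (hk : (Matrix.of k).PosSemidef)
    (hm : Measurable (Function.uncurry k)) (hb : ∀ x, |k x x| ≤ 1) {ε : ℝ} (hε : 0 ≤ ε)
    {μ : Kernel Θ Y} [IsMarkovKernel μ] {ν : Measure Y} [IsProbabilityMeasure ν] {x : ℕ → Y}
    (hx : Tendsto (fun n : ℕ => mmd k hk (empirical fun i : Fin n => x i) ν) atTop (𝓝 0))
    {θ : Θ} (hθ : ENNReal.ofReal ε < mmd k hk (μ θ) ν) :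
    Tendsto (fun n : ℕ => acceptAt (mmd k hk) ε μ (fun i : Fin n => x i) θ) atTop (𝓝 0) := by
  have htop : mmd k hk (μ θ) ν ≠ ∞ :=
    ne_top_of_le_ne_top ENNReal.ofReal_ne_top (mmd_le_two hk hb _ _)
  have hd := ENNReal.ofReal_toReal htop
  have hlt : ε < (mmd k hk (μ θ) ν).toReal := (ENNReal.ofReal_lt_iff_lt_toReal hε htop).mp hθ
  set r := (mmd k hk (μ θ) ν).toReal
  set δ := ENNReal.ofReal ((r - ε) / 2) with hδ
  have hδ0 : 0 < δ := ENNReal.ofReal_pos.mpr (by linarith)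
  have hlim := tendsto_pi_le_mmd_empirical hk hm hb (μ θ) hδ0.ne' ENNReal.ofReal_ne_top
  refine tendsto_of_tendsto_of_tendsto_of_le_of_le' tendsto_const_nhds hlim
    (Eventually.of_forall fun _ => zero_le) ?_
  filter_upwards [hx.eventually_le_const hδ0] with n hn
  refine measure_mono fun z hz => ?_
  by_contra hzB
  have hzA : mmd k hk (empirical z) (empirical fun i : Fin n => x i) ≤ ENNReal.ofReal ε := hz
  have hzB' : mmd k hk (empirical z) (μ θ) < δ := not_le.mp hzB
  have hfin : ENNReal.ofReal ε + δ ≠ ∞ :=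
    ENNReal.add_ne_top.mpr ⟨ENNReal.ofReal_ne_top, ENNReal.ofReal_ne_top⟩
  -- An accepted `z` within `δ` of `μ θ` would put `μ θ` closer to `ν` than it is, so acceptance
  -- forces an atypical sample.
  have : ENNReal.ofReal r < ENNReal.ofReal r := calc
    ENNReal.ofReal r = mmd k hk (μ θ) ν := hd
    _ ≤ mmd k hk (μ θ) (empirical z) + (mmd k hk (empirical z) (empirical fun i : Fin n => x i) +
          mmd k hk (empirical fun i : Fin n => x i) ν) :=
        (ips_triangle _ _ (empirical z) _).trans (add_le_add le_rfl (ips_triangle _ _ _ _))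
    _ ≤ mmd k hk (empirical z) (μ θ) + (ENNReal.ofReal ε + δ) :=
        add_le_add (ips_comm _ _ _).le (add_le_add hzA hn)
    _ < δ + (ENNReal.ofReal ε + δ) := ENNReal.add_lt_add_right hfin hzB'
    _ = ENNReal.ofReal r := by
        rw [hδ, ← ENNReal.ofReal_add hε (by linarith),
          ← ENNReal.ofReal_add (by linarith) (by linarith)]
        congr 1
        ring
  exact lt_irrefl _ this

theorem tendsto_acceptAt (hk : (Matrix.of k).PosSemidef)
    (hm : Measurable (Function.uncurry k)) (hb : ∀ x, |k x x| ≤ 1) {ε : ℝ} (hε : 0 ≤ ε)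
    {μ : Kernel Θ Y} [IsMarkovKernel μ] {ν : Measure Y} [IsProbabilityMeasure ν] {x : ℕ → Y}
    (hx : Tendsto (fun n : ℕ => mmd k hk (empirical fun i : Fin n => x i) ν) atTop (𝓝 0))
    {θ : Θ} (hθ : mmd k hk (μ θ) ν ≠ ENNReal.ofReal ε) :
    Tendsto (fun n : ℕ => acceptAt (mmd k hk) ε μ (fun i : Fin n => x i) θ) atTop
      (𝓝 ((withinSet (mmd k hk) ε μ ν).indicator 1 θ)) := by
  rcases lt_or_gt_of_ne hθ with h | h
  · rw [Set.indicator_of_mem (show θ ∈ withinSet (mmd k hk) ε μ ν from h.le)]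
    exact tendsto_acceptAt_one hk hm hb hx h
  · rw [Set.indicator_of_notMem (show θ ∉ withinSet (mmd k hk) ε μ ν from not_le.mpr h)]
    exact tendsto_acceptAt_zero hk hm hb hε hx h

/-- Dominated convergence with bound 1. The set `A` enters only by restricting the prior, so it may
be arbitrary. -/
theorem tendsto_setLIntegral_acceptAt (hk : (Matrix.of k).PosSemidef)
    (hm : Measurable (Function.uncurry k)) (hb : ∀ x, |k x x| ≤ 1) {ε : ℝ} (hε : 0 ≤ ε)
    {μ : Kernel Θ Y} [IsMarkovKernel μ] {prior : Measure Θ} [IsProbabilityMeasure prior]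
    {ν : Measure Y} [IsProbabilityMeasure ν]
    (hnull : prior {θ | mmd k hk (μ θ) ν = ENNReal.ofReal ε} = 0) {x : ℕ → Y}
    (hx : Tendsto (fun n : ℕ => mmd k hk (empirical fun i : Fin n => x i) ν) atTop (𝓝 0))
    (A : Set Θ) :
    Tendsto (fun n : ℕ => ∫⁻ θ in A, acceptAt (mmd k hk) ε μ (fun i : Fin n => x i) θ ∂prior)
      atTop (𝓝 (prior (withinSet (mmd k hk) ε μ ν ∩ A))) := by
  have hS := measurableSet_withinSet hk hm hb ε μ ν
  rw [← Measure.restrict_apply hS, ← lintegral_indicator_one hS]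
  refine tendsto_lintegral_filter_of_dominated_convergence 1 ?_ ?_ (by simp) ?_
  · filter_upwards [eventually_ge_atTop 1] with n hn
    have : NeZero n := ⟨by omega⟩
    exact measurable_acceptAt hk hm hb ε μ _
  · exact Eventually.of_forall fun n => ae_of_all _ fun θ => acceptAt_le_one _ _ _ _ _
  · have hne : ∀ᵐ θ ∂prior, mmd k hk (μ θ) ν ≠ ENNReal.ofReal ε := by
      rw [ae_iff]; simpa using hnull
    filter_upwards [ae_restrict_of_ae hne] with θ hθ
    exact tendsto_acceptAt hk hm hb hε hx hθ

theorem tendsto_acceptProb (hk : (Matrix.of k).PosSemidef)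
    (hm : Measurable (Function.uncurry k)) (hb : ∀ x, |k x x| ≤ 1) {ε : ℝ} (hε : 0 ≤ ε)
    {μ : Kernel Θ Y} [IsMarkovKernel μ] {prior : Measure Θ} [IsProbabilityMeasure prior]
    {ν : Measure Y} [IsProbabilityMeasure ν]
    (hnull : prior {θ | mmd k hk (μ θ) ν = ENNReal.ofReal ε} = 0) {x : ℕ → Y}
    (hx : Tendsto (fun n : ℕ => mmd k hk (empirical fun i : Fin n => x i) ν) atTop (𝓝 0)) :
    Tendsto (fun n : ℕ => acceptProb (mmd k hk) ε μ prior (fun i : Fin n => x i)) atTop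
      (𝓝 (prior (withinSet (mmd k hk) ε μ ν))) := by
  simpa [acceptProb] using tendsto_setLIntegral_acceptAt hk hm hb hε hnull hx Set.univ

theorem acceptProb_ne_top (D : Measure Y → Measure Y → ℝ≥0∞) (ε : ℝ) (μ : Kernel Θ Y)
    [IsMarkovKernel μ] (prior : Measure Θ) [IsProbabilityMeasure prior] {n : ℕ} (x : Fin n → Y) :
    acceptProb D ε μ prior x ≠ ∞ := by
  refine ne_top_of_le_ne_top ENNReal.one_ne_top ?_
  refine (lintegral_mono fun θ => acceptAt_le_one D ε μ x θ).trans_eq ?_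
  simp

theorem posterior_apply (D : Measure Y → Measure Y → ℝ≥0∞) (ε : ℝ) (μ : Kernel Θ Y)
    (prior : Measure Θ) {n : ℕ} (x : Fin n → Y) (h0 : acceptProb D ε μ prior x ≠ 0) {A : Set Θ}
    (hA : MeasurableSet A) :
    posterior D ε μ prior x A =
      (∫⁻ θ in A, acceptAt D ε μ x θ ∂prior) / acceptProb D ε μ prior x := by
  rw [posterior, withDensity_apply _ hA]
  simp only [posteriorDensity, div_eq_mul_inv]
  exact lintegral_mul_const' _ _ (ENNReal.inv_ne_top.mpr h0)

theorem isProbabilityMeasure_posterior (D : Measure Y → Measure Y → ℝ≥0∞) (ε : ℝ)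
    (μ : Kernel Θ Y) [IsMarkovKernel μ] (prior : Measure Θ) [IsProbabilityMeasure prior] {n : ℕ}
    (x : Fin n → Y) (h0 : acceptProb D ε μ prior x ≠ 0) :
    IsProbabilityMeasure (posterior D ε μ prior x) := by
  refine ⟨?_⟩
  rw [posterior_apply D ε μ prior x h0 MeasurableSet.univ, Measure.restrict_univ, ← acceptProb]
  exact ENNReal.div_self h0 (acceptProb_ne_top D ε μ prior x)

theorem prior_withinSet_pos (hk : (Matrix.of k).PosSemidef) (hb : ∀ x, |k x x| ≤ 1) {ε : ℝ}
    {μ : Kernel Θ Y} [IsMarkovKernel μ] {prior : Measure Θ} [IsProbabilityMeasure prior]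
    {ν : Measure Y} [IsProbabilityMeasure ν]
    (h : criticalThreshold (mmd k hk) μ prior ν < ε) :
    0 < prior (withinSet (mmd k hk) ε μ ν) := by
  -- Over the empty set the real `sInf` would be 0 and carry no information. The threshold 2 always
  -- qualifies, as it bounds the MMD of any two probability measures.
  have hne : {ε : ℝ | 0 < ε ∧ 0 < prior (withinSet (mmd k hk) ε μ ν)}.Nonempty := by
    refine ⟨2, two_pos, ?_⟩
    have : withinSet (mmd k hk) 2 μ ν = Set.univ :=
      Set.eq_univ_of_forall fun θ => mmd_le_two hk hb (μ θ) ν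
    simp [this]
  obtain ⟨ε', ⟨-, hpos⟩, hlt⟩ := exists_lt_of_csInf_lt hne h
  exact hpos.trans_le (measure_mono fun θ hθ =>
    (show mmd k hk (μ θ) ν ≤ _ from hθ).trans (ENNReal.ofReal_le_ofReal hlt.le))

end ABC

theorem mainTheorem8 {Y Θ Ω : Type*} [MeasurableSpace Y] [MeasurableSpace Θ] [MeasurableSpace Ω]
    (k : Y → Y → ℝ) (hk : (Matrix.of k).PosSemidef)
    (hk_meas : Measurable (Function.uncurry k)) (hk_bdd : ∀ x, |k x x| ≤ 1)
    (μ : Kernel Θ Y) [IsMarkovKernel μ]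
    (prior : Measure Θ) [IsProbabilityMeasure prior]
    (μstar : Measure Y) [IsProbabilityMeasure μstar]
    (P : Measure Ω) [IsProbabilityMeasure P]
    (y : ℕ → Ω → Y) (hy_law : ∀ i, HasLaw (y i) μstar P) (hy_indep : iIndepFun y P)
    (ε : ℝ) (hε : 0 < ε)
    (hε_null : prior {θ | ABC.mmd k hk (μ θ) μstar = ENNReal.ofReal ε} = 0) :
    (∀ᵐ ω ∂P, Tendsto
        (fun n : ℕ => ABC.acceptProb (ABC.mmd k hk) ε μ prior (fun i : Fin n => y i ω)) atTop
        (𝓝 (prior (ABC.withinSet (ABC.mmd k hk) ε μ μstar)))) ∧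
    (ABC.criticalThreshold (ABC.mmd k hk) μ prior μstar < ε →
      0 < prior (ABC.withinSet (ABC.mmd k hk) ε μ μstar) ∧
      ∀ᵐ ω ∂P,
        (∀ᶠ n : ℕ in atTop, IsProbabilityMeasure
          (ABC.posterior (ABC.mmd k hk) ε μ prior (fun i : Fin n => y i ω))) ∧
        (∀ᵐ θ ∂prior, Tendsto
          (fun n : ℕ =>
            ABC.posteriorDensity (ABC.mmd k hk) ε μ prior (fun i : Fin n => y i ω) θ) atTop
          (𝓝 ((ABC.withinSet (ABC.mmd k hk) ε μ μstar).indicator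
            (fun _ => (prior (ABC.withinSet (ABC.mmd k hk) ε μ μstar))⁻¹) θ))) ∧
        (∀ A : Set Θ, MeasurableSet A → Tendsto
          (fun n : ℕ =>
            ABC.posterior (ABC.mmd k hk) ε μ prior (fun i : Fin n => y i ω) A) atTop
          (𝓝 (cond prior (ABC.withinSet (ABC.mmd k hk) ε μ μstar) A)))) := by
  have hx := ABC.ae_tendsto_mmd_empirical hk hk_meas hk_bdd hy_law hy_indep
  refine ⟨?_, fun hthr => ?_⟩
  · filter_upwards [hx] with ω hω
    exact ABC.tendsto_acceptProb hk hk_meas hk_bdd hε.le hε_null (x := fun i => y i ω) hω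
  have hpos := ABC.prior_withinSet_pos hk hk_bdd hthr
  refine ⟨hpos, ?_⟩
  -- This single event supports all three conclusions, so the exceptional set depends on neither `θ`
  -- nor `A`.
  filter_upwards [hx] with ω hω
  have hprob := ABC.tendsto_acceptProb hk hk_meas hk_bdd hε.le hε_null (x := fun i => y i ω) hω
  have hev := hprob.eventually_ne hpos.ne'
  refine ⟨?_, ?_, fun A hA => ?_⟩
  · filter_upwards [hev] with n hn
    exact ABC.isProbabilityMeasure_posterior _ _ _ _ _ hn
  · have hne : ∀ᵐ θ ∂prior, ABC.mmd k hk (μ θ) μstar ≠ ENNReal.ofReal ε := by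
      rw [ae_iff]; simpa using hε_null
    filter_upwards [hne] with θ hθ
    have h := ENNReal.Tendsto.div (ABC.tendsto_acceptAt hk hk_meas hk_bdd hε.le (x := fun i => y i ω) hω hθ)
      (Or.inr hpos.ne') hprob (Or.inl (measure_ne_top _ _))
    rw [div_eq_mul_inv, ← Set.indicator_mul_const] at h
    simpa only [ABC.posteriorDensity, Pi.one_apply, one_mul] using h
  · have h := ENNReal.Tendsto.div
      (ABC.tendsto_setLIntegral_acceptAt hk hk_meas hk_bdd hε.le hε_null (x := fun i => y i ω) hω A)
      (Or.inr hpos.ne') hprob (Or.inl (measure_ne_top _ _))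
    rw [cond_apply (ABC.measurableSet_withinSet hk hk_meas hk_bdd ε μ μstar), mul_comm,
      ← div_eq_mul_inv]
    refine h.congr' ?_
    filter_upwards [hev] with n hn
    exact (ABC.posterior_apply _ _ _ _ _ hn hA).symm
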